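/- Let $N\ge 1$. Let $A:\mathbb R\times\mathbb R\to \mathrm{Mat}_{N\times N}(\mathbb C)$ be continuously differentiable, with $A(\gamma,t+T)=A(\gamma,t)$ and $A(\gamma+l,t)=A(\gamma,t)$ for some $T>0$ and all $l$ in a lattice $L\subset\mathbb R$. Let $X(\gamma,t)$ be the fundamental solution of $\frac{d}{dt}X=A(\gamma,t)X$, $X(\gamma,0)=\mathrm{Id}_N$, and assume that the monodromy matrix $\gamma\mapsto X(\gamma,T)$ is locally $C^1$-diagonalizable: near every $\gamma$ there are $C^1$ functions $\lambda_1,\dots,\lambda_N$ with values in $\mathbb C$ and $\eta_1,\dots,\eta_N$ with values in $\mathbb{CP}^{N-1}$ such that each line $\eta_n$ consists of eigenvectors of $X(\cdot,T)$ for the eigenvalue $\lambda_n$ and the lines $\eta_1,\dots,\eta_N$ span $\mathbb C^N$. Fix such $C^1$ functions $\lambda_1,\dots,\lambda_N$ and $\eta_1,\dots,\eta_N$ on all of $\mathbb R$, and $C^1$ functions $\mu_1,\dots,\mu_N:\mathbb R\to\mathbb C$ with $\exp(T\mu_n)=\lambda_n$. Let $L_n\subset L$ be the maximal subgroup of $L$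 such that $\lambda_n$ is $L_n$-periodic. Assume that $L_n$ is a lattice (i.e. $L_n\neq 0$), that $\eta_n$ is $L_n$-periodic as well, and that the (Type II.a) homotopy class of $\lambda_n$ in $[\mathbb R/L_n,\mathbb C^*]$ is trivial, for every $n$. Put $\tilde L=\bigcap_n L_n$, let $F(\gamma)$ be the matrix with $F(\gamma)v=\mu_n(\gamma)v$ for $v\in\eta_n(\gamma)$, $1\le n\le N$, and let $P(\gamma,t)=X(\gamma,t)\exp(-tF(\gamma))$ be the Lyapunov transform. Then $\tilde L=p\mathbb Z$ for some $p>0$, and $P$ defines a continuous map $\mathbb R/\tilde L\times\mathbb R/T\mathbb Z\to GL_N(\mathbb C)$. The homotopy class of this map in $[\mathbb T^2,GL_N(\mathbb C)]$ (the Type II.b homotopy class), where $\mathbb T^2=\mathbb R/\mathbb Z\times\mathbb R/\mathbb Z$ is identified with $\mathbb R/\tilde L\times\mathbb R/T\mathbb Z$ by $(x,s)\mapsto(px,Ts)$, is uniquely determined by the class in $\pi_1(S^1)$ of the loop $$\mathbb R/T\mathbb Z\ni t\longmapsto \frac{\det P(0,t)}{|\det P(0,t)|}\in S^1 .$$ That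 is, there is a function $\Phi_N:\pi_1(S^1)\to[\mathbb T^2,GL_N(\mathbb C)]$, depending only on $N$, such that for all data as above the Type II.b homotopy class of $P$ is the value of $\Phi_N$ at the class of this loop. -/

import Mathlib

open scoped LinearAlgebra.Projectivization

noncomputable section

namespace Floquet

variable {N : ℕ}

/-- `X` is the fundamental solution of the family `dX/dt = A(γ,t) X`, `X(γ,0) = Id`, `γ ∈ ℝ`. The
derivative is taken entry by entry. -/
def IsFundamentalSolution (A X : ℝ → ℝ → Matrix (Fin N) (Fin N) ℂ) : Prop :=
  (∀ γ, X γ 0 = 1) ∧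
    ∀ γ t i j, HasDerivAt (fun s => X γ s i j) ((A γ t * X γ t) i j) t

/-- A map `η : W → ℂP^{N-1}` is continuously differentiable: near every point of `W` it is
`γ ↦ [v(γ)]` for a nowhere vanishing `C¹` map `v` with values in `ℂ^N`. -/
def IsC1ProjOn (η : ℝ → ℙ ℂ (Fin N → ℂ)) (W : Set ℝ) : Prop :=
  ∀ γ₀ ∈ W, ∃ U : Set ℝ, IsOpen U ∧ γ₀ ∈ U ∧ ∃ v : ℝ → Fin N → ℂ, ContDiffOn ℝ 1 v (U ∩ W) ∧
    ∀ γ ∈ U ∩ W, ∃ h : v γ ≠ 0, η γ = Projectivization.mk ℂ (v γ) h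

/-- On the open set `W`, the functions `lam 1, …, lam N` and the lines `η 1, …, η N` are `C¹`,
`η n` consists of eigenvectors of `M` for the eigenvalue `lam n`, and the lines span `ℂ^N`. Hence
`lam 1, …, lam N` is the list of eigenvalues of `M`, with multiplicity. -/
def IsC1DiagonalizationOn (M : ℝ → Matrix (Fin N) (Fin N) ℂ) (W : Set ℝ)
    (lam : Fin N → ℝ → ℂ) (η : Fin N → ℝ → ℙ ℂ (Fin N → ℂ)) : Prop :=
  (∀ n, ContDiffOn ℝ 1 (lam n) W) ∧ (∀ n, IsC1ProjOn (η n) W) ∧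
    ∀ γ ∈ W, (∀ n, ∀ v ∈ (η n γ).submodule, (M γ).mulVec v = lam n γ • v) ∧
      ⨆ n, (η n γ).submodule = ⊤

/-- Local `C¹`-diagonalizability of a matrix-valued function on `ℝ`. -/
def LocallyC1Diagonalizable (M : ℝ → Matrix (Fin N) (Fin N) ℂ) : Prop :=
  ∀ γ₀ : ℝ, ∃ W : Set ℝ, IsOpen W ∧ γ₀ ∈ W ∧
    ∃ lam η, IsC1DiagonalizationOn M W lam η

/-- The maximal subgroup of `L` all of whose elements are periods of `f`. -/
def periodLattice (L : AddSubgroup ℝ) (f : ℝ → ℂ) : AddSubgroup ℝ where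
  carrier := {l | l ∈ L ∧ ∀ γ, f (γ + l) = f γ}
  zero_mem' := ⟨L.zero_mem, fun γ => by rw [add_zero]⟩
  add_mem' := fun {a b} ha hb =>
    ⟨L.add_mem ha.1 hb.1, fun γ => by rw [← add_assoc, hb.2, ha.2]⟩
  neg_mem' := fun {a} ha =>
    ⟨L.neg_mem ha.1, fun γ => by
      have h := ha.2 (γ + -a)
      rw [neg_add_cancel_right] at h
      exact h.symm⟩

/-- The homotopy class of `f : ℝ/Λ → ℂ*`, where `f` is given as a `Λ`-periodic function on `ℝ`, is
trivial. -/
def HasTrivialClass (Λ : AddSubgroup ℝ) (f : ℝ → ℂ) : Prop :=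
  ∃ g : C(ℝ ⧸ Λ, ℂˣ), (∀ γ : ℝ, (g (γ : ℝ ⧸ Λ) : ℂ) = f γ) ∧ g.Nullhomotopic

/-- The Floquet exponent matrix `F(γ) = V diag(μ 1, …, μ N) V⁻¹`, where the `n`-th column of `V`
is a vector that spans the line `η n`. (`F` does not depend on the choice of these vectors.) -/
def exponentMatrix (μ : Fin N → ℝ → ℂ) (η : Fin N → ℝ → ℙ ℂ (Fin N → ℂ)) (γ : ℝ) :
    Matrix (Fin N) (Fin N) ℂ :=
  let V : Matrix (Fin N) (Fin N) ℂ := Matrix.of fun i n => (η n γ).rep i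
  V * Matrix.diagonal (fun n => μ n γ) * V⁻¹

/-- A periodic linear system `dX/dt = A(γ,t) X` of size `N`, periodically parameterized by
`γ ∈ ℝ` modulo the lattice `L = ℓℤ`, together with the choices that define a Lyapunov transform. -/
structure ParamSystem (N : ℕ) where
  /-- the coefficient matrix -/
  A : ℝ → ℝ → Matrix (Fin N) (Fin N) ℂ
  /-- the period in time -/
  T : ℝ
  T_pos : 0 < T
  /-- the generator of the lattice `L` of parameter periods -/
  ℓ : ℝ
  ℓ_pos : 0 < ℓ
  contDiff_A : ∀ i j, ContDiff ℝ 1 (fun q : ℝ × ℝ => A q.1 q.2 i j)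
  periodic_time : ∀ γ t, A γ (t + T) = A γ t
  periodic_param : ∀ γ t, A (γ + ℓ) t = A γ t
  /-- the fundamental solution -/
  X : ℝ → ℝ → Matrix (Fin N) (Fin N) ℂ
  fundamental : IsFundamentalSolution A X
  locallyDiag : LocallyC1Diagonalizable (fun γ => X γ T)
  /-- the characteristic multipliers, i.e. the eigenvalues of the monodromy matrix `X(γ,T)` -/
  lam : Fin N → ℝ → ℂ
  /-- the corresponding eigenspaces -/
  η : Fin N → ℝ → ℙ ℂ (Fin N → ℂ)
  diag : IsC1DiagonalizationOn (fun γ => X γ T) Set.univ lam η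
  /-- the group `L_n` of those elements of `L` that are periods of `lam n` is a lattice -/
  lattice_ne_bot : ∀ n, periodLattice (AddSubgroup.zmultiples ℓ) (lam n) ≠ ⊥
  /-- `η n` is a function on `ℝ/L_n` -/
  η_periodic : ∀ n, ∀ l ∈ periodLattice (AddSubgroup.zmultiples ℓ) (lam n), ∀ γ,
    η n (γ + l) = η n γ
  /-- the characteristic exponents -/
  μ : Fin N → ℝ → ℂ
  contDiff_μ : ∀ n, ContDiff ℝ 1 (μ n)
  exp_μ : ∀ n γ, Complex.exp (T * μ n γ) = lam n γ
  /-- the Type II.a homotopy class of `lam n` in `[ℝ/L_n, ℂ*]` is trivial -/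
  typeIIa_trivial : ∀ n,
    HasTrivialClass (periodLattice (AddSubgroup.zmultiples ℓ) (lam n)) (lam n)

namespace ParamSystem

/-- The lattice `L̃ = ⋂ L_n`. -/
def Ltilde (S : ParamSystem N) : AddSubgroup ℝ :=
  ⨅ n, periodLattice (AddSubgroup.zmultiples S.ℓ) (S.lam n)

/-- The Lyapunov transform `P(γ,t) = X(γ,t) exp(-t F(γ))`. -/
def P (S : ParamSystem N) (γ t : ℝ) : Matrix (Fin N) (Fin N) ℂ :=
  S.X γ t * NormedSpace.exp (-((t : ℂ) • exponentMatrix S.μ S.η γ))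

/-- `f` is the Lyapunov transform, viewed as a continuous map `ℝ/pℤ × ℝ/Tℤ → GL_N(ℂ)`. There is
at most one such `f`. -/
def IsLyapunovMap (S : ParamSystem N) (p : ℝ)
    (f : C(AddCircle p × AddCircle S.T, Matrix.GeneralLinearGroup (Fin N) ℂ)) : Prop :=
  ∀ γ t : ℝ, (f ((γ : AddCircle p), (t : AddCircle S.T)) : Matrix (Fin N) (Fin N) ℂ) = S.P γ t

/-- `w` is the loop `Δ ∘ P ∘ ι`, `t ↦ det P(0,t) / |det P(0,t)|` for `t ∈ ℝ/Tℤ`, parameterized by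
`s = t/T ∈ [0,1]`. There is at most one such `w`. -/
def IsDetLoop (S : ParamSystem N) (w : Path (1 : Circle) 1) : Prop :=
  ∀ s : unitInterval,
    (w s : ℂ) = (S.P 0 (s * S.T)).det / (‖(S.P 0 (s * S.T)).det‖ : ℂ)

end ParamSystem

/-- The set `[X, Y]` of (free) homotopy classes of continuous maps. -/
def HomotopyClasses (X Y : Type*) [TopologicalSpace X] [TopologicalSpace Y] : Type _ :=
  Quotient (⟨ContinuousMap.Homotopic, ContinuousMap.Homotopic.equivalence⟩ : Setoid C(X, Y))

/-- The homotopy class of a continuous map. -/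
def homotopyClass {X Y : Type*} [TopologicalSpace X] [TopologicalSpace Y] (f : C(X, Y)) :
    HomotopyClasses X Y :=
  Quotient.mk _ f

/-- The standard identification of `𝕋² = ℝ/ℤ × ℝ/ℤ` with `ℝ/pℤ × ℝ/Tℤ`, `(x, s) ↦ (px, Ts)`. -/
def torusHomeo (p T : ℝ) (hp : p ≠ 0) (hT : T ≠ 0) :
    UnitAddCircle × UnitAddCircle ≃ₜ AddCircle p × AddCircle T :=
  (AddCircle.homeomorphAddCircle 1 p one_ne_zero hp).prodCongr
    (AddCircle.homeomorphAddCircle 1 T one_ne_zero hT)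

/-- The Type II.b homotopy class, in `[𝕋², GL_N(ℂ)]`, of a map `f : ℝ/pℤ × ℝ/Tℤ → GL_N(ℂ)`. -/
def torusClass {p T : ℝ} (hp : 0 < p) (hT : 0 < T)
    (f : C(AddCircle p × AddCircle T, Matrix.GeneralLinearGroup (Fin N) ℂ)) :
    HomotopyClasses (UnitAddCircle × UnitAddCircle) (Matrix.GeneralLinearGroup (Fin N) ℂ) :=
  homotopyClass (f.comp ⟨torusHomeo p T hp.ne' hT.ne', (torusHomeo p T hp.ne' hT.ne').continuous⟩)

/-- The class of a loop in `π₁(S¹)`. -/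
def loopClass (w : Path (1 : Circle) 1) : FundamentalGroup Circle 1 :=
  FundamentalGroup.fromPath (Path.Homotopic.Quotient.mk w)

end Floquet

end

/-! The group `SL_N(ℂ)` has vanishing `π₁` and `π₂`, so a map from a 2-dimensional complex to
`GL_N(ℂ)` is determined up to homotopy by its determinant. The determinant, a map `𝕋² → ℂ*`, is
determined up to homotopy by its winding numbers along the two circles. Since `P(γ,0) = 1`, the
winding in the `γ` direction is zero, and the other one is the degree `k` of the given loop. So `Φ`
can send a class of degree `k` to the class of `diag(1, …, 1, e^{2πiks})`.

The topological input (`matHomotopic_lastDiag_det`) is obtained by dimension counting instead of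
homotopy groups: a `C¹` image of `ℝ²` or `ℝ³` in `ℂ² = ℝ⁴` has dense complement. After `C¹`
approximation this lets the first column be moved to `e₀`, and induction on the size leaves `diag(1,
…, 1, d)`. The winding argument is `exists_log_ratio`.

It remains that `P` lives on the torus. Time periodicity is Floquet's theorem, `exp(TF) = X(·,T)`.
Parameter periodicity uses the trivial Type II.a classes: they make the logarithms `μ_n` periodic
along `L_n`, not just the `λ_n`. -/

noncomputable section

namespace Floquet

/-! ### Homotopies of invertible matrix functions -/

section MatHomotopy

open unitInterval Matrix

variable {K : Type*} [TopologicalSpace K] {n : Type*} [Fintype n] [DecidableEq n]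

/-- A continuous matrix-valued map with nonvanishing determinant, as a map to `GL`. -/
def toGLMap (M : K → Matrix n n ℂ) (hM : Continuous M) (hd : ∀ x, (M x).det ≠ 0) :
    C(K, GL n ℂ) where
  toFun x := GeneralLinearGroup.mkOfDetNeZero (M x) (hd x)
  continuous_toFun := by
    refine Units.continuous_iff.mpr ⟨hM, ?_⟩
    refine continuous_iff_continuousAt.mpr fun x => ?_
    have h : ContinuousAt (fun y => (M y)⁻¹) x :=
      (continuousAt_matrix_inv (M x) (by
        simpa using continuousAt_inv₀ (hd x))).comp hM.continuousAt
    refine h.congr (Filter.Eventually.of_forall fun y => ?_)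
    simp only [coe_units_inv]
    rfl

/-- Two invertible matrix-valued functions are continuous and homotopic as maps to `GL`. -/
def MatHomotopic (f g : K → Matrix n n ℂ) : Prop :=
  ∃ f' g' : C(K, GL n ℂ), (∀ x, (f' x : Matrix n n ℂ) = f x) ∧
    (∀ x, (g' x : Matrix n n ℂ) = g x) ∧ f'.Homotopic g'

lemma MatHomotopic.trans {f g h : K → Matrix n n ℂ} (h₁ : MatHomotopic f g)
    (h₂ : MatHomotopic g h) : MatHomotopic f h := by
  obtain ⟨a, b, ha, hb, hab⟩ := h₁
  obtain ⟨c, d, hc, hd, hcd⟩ := h₂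
  have : b = c := by
    ext1 x
    exact Units.ext ((hb x).trans (hc x).symm)
  subst this
  exact ⟨a, d, ha, hd, hab.trans hcd⟩

lemma MatHomotopic.symm {f g : K → Matrix n n ℂ} (h : MatHomotopic f g) : MatHomotopic g f := by
  obtain ⟨a, b, ha, hb, hab⟩ := h
  exact ⟨b, a, hb, ha, hab.symm⟩

lemma MatHomotopic.homotopic {f g : C(K, GL n ℂ)}
    (h : MatHomotopic (fun x => (f x : Matrix n n ℂ)) (fun x => (g x : Matrix n n ℂ))) :
    f.Homotopic g := by
  obtain ⟨a, b, ha, hb, hab⟩ := h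
  have h₁ : a = f := by
    ext1 x
    exact Units.ext (ha x)
  have h₂ : b = g := by
    ext1 x
    exact Units.ext (hb x)
  rwa [← h₁, ← h₂]

/-- A homotopy through invertible matrices. -/
lemma MatHomotopic.of_path {f g : K → Matrix n n ℂ} (H : I × K → Matrix n n ℂ) (hc : Continuous H)
    (hd : ∀ q, (H q).det ≠ 0) (hf : ∀ x, H (0, x) = f x) (hg : ∀ x, H (1, x) = g x) :
    MatHomotopic f g := by
  have hfg : ∀ s : I, Continuous fun x => H (s, x) := fun s => by fun_prop
  refine ⟨toGLMap _ (hfg 0) fun x => hd (0, x), toGLMap _ (hfg 1) fun x => hd (1, x), hf, hg,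
    ⟨⟨toGLMap H hc hd, fun x => ?_, fun x => ?_⟩⟩⟩ <;> exact Units.ext rfl

lemma MatHomotopic.exists_path {f g : K → Matrix n n ℂ} (h : MatHomotopic f g) :
    ∃ H : I × K → Matrix n n ℂ, Continuous H ∧ (∀ q, (H q).det ≠ 0) ∧ (∀ x, H (0, x) = f x) ∧
      ∀ x, H (1, x) = g x := by
  obtain ⟨a, b, ha, hb, ⟨G⟩⟩ := h
  refine ⟨fun q => G q, Units.continuous_val.comp G.continuous,
    fun q => ((Matrix.isUnit_iff_isUnit_det _).1 (G q).isUnit).ne_zero, fun x => ?_, fun x => ?_⟩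
  · rw [← ha]; simp
  · rw [← hb]; simp

lemma MatHomotopic.continuous_left {f g : K → Matrix n n ℂ} (h : MatHomotopic f g) :
    Continuous f := by
  obtain ⟨a, b, ha, hb, -⟩ := h
  have : f = fun x => (a x : Matrix n n ℂ) := funext fun x => (ha x).symm
  rw [this]
  exact Units.continuous_val.comp a.continuous

lemma MatHomotopic.det_ne_zero {f g : K → Matrix n n ℂ} (h : MatHomotopic f g) (x : K) :
    (f x).det ≠ 0 := by
  obtain ⟨H, -, hd, hf, -⟩ := h.exists_path
  rw [← hf]
  exact hd _

lemma MatHomotopic.map {m : Type*} [Fintype m] [DecidableEq m] {f g : K → Matrix n n ℂ}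
    (h : MatHomotopic f g) (Ψ : Matrix n n ℂ → Matrix m m ℂ) (hΨ : Continuous Ψ)
    (hΨd : ∀ M, M.det ≠ 0 → (Ψ M).det ≠ 0) :
    MatHomotopic (fun x => Ψ (f x)) (fun x => Ψ (g x)) := by
  obtain ⟨H, hc, hd, hf, hg⟩ := h.exists_path
  exact .of_path (fun q => Ψ (H q)) (hΨ.comp hc) (fun q => hΨd _ (hd q))
    (fun x => by rw [hf]) (fun x => by rw [hg])

lemma MatHomotopic.refl {f : K → Matrix n n ℂ} (hf : Continuous f) (hd : ∀ x, (f x).det ≠ 0) :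
    MatHomotopic f f :=
  .of_path (fun q => f q.2) (by fun_prop) (fun q => hd _) (fun _ => rfl) fun _ => rfl

/-- Nearby maps from a compact space to the invertible matrices are homotopic. -/
lemma exists_near_matHomotopic [CompactSpace K] {f : K → Matrix n n ℂ} (hf : Continuous f)
    (hd : ∀ x, (f x).det ≠ 0) :
    ∃ δ > 0, ∀ g : K → Matrix n n ℂ, Continuous g → (∀ x i j, ‖g x i j - f x i j‖ < δ) →
      MatHomotopic f g := by
  let U : Set (n → n → ℂ) := {M | (Matrix.of M).det ≠ 0}
  have hU : IsOpen U := isOpen_ne_fun (Continuous.matrix_det continuous_id) continuous_const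
  obtain ⟨δ, hδ, hsub⟩ := (isCompact_range (f := fun x => (f x : n → n → ℂ))
    hf).exists_thickening_subset_open hU (by rintro _ ⟨x, rfl⟩; exact hd x)
  refine ⟨δ, hδ, fun g hg hgf => ?_⟩
  have key : ∀ (s : I) x, (f x + (s : ℂ) • (g x - f x)).det ≠ 0 := by
    intro s x
    refine hsub (Metric.mem_thickening_iff.2 ⟨f x, ⟨x, rfl⟩, ?_⟩)
    refine (dist_pi_lt_iff hδ).2 fun i => (dist_pi_lt_iff hδ).2 fun j => ?_
    rw [dist_eq_norm]
    have : (f x + (s : ℂ) • (g x - f x)) i j - f x i j = s * (g x i j - f x i j) := by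
      simp
    refine (congrArg norm this).trans_lt ?_
    rw [norm_mul, Complex.norm_real, Real.norm_of_nonneg s.2.1]
    exact (mul_le_of_le_one_left (norm_nonneg _) s.2.2).trans_lt (hgf x i j)
  refine .of_path (fun q => f q.2 + ((q.1 : ℝ) : ℂ) • (g q.2 - f q.2)) (by fun_prop)
    (fun q => key q.1 q.2) ?_ ?_ <;> simp

/-- Left multiplication by a unipotent rank-one perturbation of the identity. -/
lemma matHomotopic_rankOne_mul {f : K → Matrix n n ℂ} (hf : Continuous f)
    (hd : ∀ x, (f x).det ≠ 0) {a b : K → n → ℂ} (ha : Continuous a) (hb : Continuous b)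
    (hab : ∀ x, b x ⬝ᵥ a x = 0) :
    MatHomotopic f (fun x => (1 + vecMulVec (a x) (b x)) * f x) := by
  refine .of_path (fun q => (1 + vecMulVec (((q.1 : ℝ) : ℂ) • a q.2) (b q.2)) * f q.2) ?_ ?_ ?_ ?_
  · have h₁ : Continuous fun q : I × K => ((q.1 : ℝ) : ℂ) • a q.2 := by fun_prop
    exact (continuous_const.add (h₁.matrix_vecMulVec (hb.comp continuous_snd))).matrix_mul
      (hf.comp continuous_snd)
  · rintro ⟨s, x⟩
    rw [det_mul, vecMulVec_eq Unit, det_one_add_replicateCol_mul_replicateRow, dotProduct_smul,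
      hab, smul_zero, add_zero, one_mul]
    exact hd x
  · simp
  · simp

lemma rankOne_mul_col (a b : n → ℂ) (M : Matrix n n ℂ) (i j : n) :
    ((1 + vecMulVec a b) * M) i j = M i j + a i * (b ⬝ᵥ fun k => M k j) := by
  rw [Matrix.add_mul, Matrix.one_mul, Matrix.add_apply, vecMulVec_mul]
  rfl

end MatHomotopy

/-! ### `C¹` approximation on the torus -/

section SmoothApproximation

/-- The functions on the torus whose pullback to the plane is continuously differentiable. -/
def smoothTorusFunctions : StarSubalgebra ℂ C(UnitAddCircle × UnitAddCircle, ℂ) where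
  carrier := {f | ContDiff ℝ 1 fun q : ℝ × ℝ => f ((q.1 : UnitAddCircle), (q.2 : UnitAddCircle))}
  mul_mem' := fun {f g} hf hg => by
    rw [Set.mem_ofPred_eq] at *
    exact hf.mul hg
  add_mem' := fun {f g} hf hg => by
    rw [Set.mem_ofPred_eq] at *
    exact hf.add hg
  algebraMap_mem' := fun c => by
    rw [Set.mem_ofPred_eq]
    exact contDiff_const (c := c)
  star_mem' := fun {f} hf => by
    rw [Set.mem_ofPred_eq] at *
    exact Complex.conjCLE.contDiff.comp hf

lemma contDiff_fourier_one : ContDiff ℝ 1 fun x : ℝ => fourier 1 (x : UnitAddCircle) := by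
  have : (fun x : ℝ => fourier 1 (x : UnitAddCircle)) =
      fun x : ℝ => Complex.exp (2 * Real.pi * Complex.I * x) := by
    funext x
    rw [fourier_coe_apply]
    simp
  rw [this]
  exact (contDiff_const.mul Complex.ofRealCLM.contDiff).cexp

lemma smoothTorusFunctions_separatesPoints : smoothTorusFunctions.SeparatesPoints := by
  have inj : ∀ a b : UnitAddCircle, a ≠ b → fourier 1 a ≠ fourier 1 b := by
    intro a b hab h
    rw [fourier_one, fourier_one] at h
    exact hab (AddCircle.injective_toCircle one_ne_zero (Subtype.ext h))
  rintro ⟨a, b⟩ ⟨c, d⟩ hne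
  by_cases hac : a = c
  · have hbd : b ≠ d := fun h => hne (by rw [hac, h])
    refine ⟨_, ⟨(fourier 1).comp ⟨Prod.snd, continuous_snd⟩,
      contDiff_fourier_one.comp contDiff_snd, rfl⟩, inj b d hbd⟩
  · exact ⟨_, ⟨(fourier 1).comp ⟨Prod.fst, continuous_fst⟩,
      contDiff_fourier_one.comp contDiff_fst, rfl⟩, inj a c hac⟩

/-- Stone–Weierstrass for the star subalgebra of `C¹` functions. -/
lemma exists_smooth_near (f : C(UnitAddCircle × UnitAddCircle, ℂ)) {ε : ℝ} (hε : 0 < ε) :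
    ∃ g ∈ smoothTorusFunctions, ∀ x, ‖g x - f x‖ < ε := by
  have h := ContinuousMap.starSubalgebra_topologicalClosure_eq_top_of_separatesPoints
    smoothTorusFunctions smoothTorusFunctions_separatesPoints
  have hf : f ∈ smoothTorusFunctions.topologicalClosure := by rw [h]; trivial
  obtain ⟨g, hg, hgf⟩ := Metric.mem_closure_iff.1 (hf : f ∈ closure _) ε hε
  refine ⟨g, hg, fun x => ?_⟩
  rw [← dist_eq_norm, dist_comm]
  exact (ContinuousMap.dist_apply_le_dist x).trans_lt hgf

open Matrix in
/-- An invertible matrix function on the torus is homotopic to every function which is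
sufficiently close to a suitable continuously differentiable one. -/
lemma exists_smooth_matHomotopic {n : ℕ}
    {f : UnitAddCircle × UnitAddCircle → Matrix (Fin n) (Fin n) ℂ}
    (hf : Continuous f) (hd : ∀ x, (f x).det ≠ 0) :
    ∃ g : UnitAddCircle × UnitAddCircle → Matrix (Fin n) (Fin n) ℂ, Continuous g ∧
      (∀ i j, ContDiff ℝ 1 fun q : ℝ × ℝ => g ((q.1 : UnitAddCircle), (q.2 : UnitAddCircle)) i j) ∧
      ∃ δ > 0, ∀ C : Matrix (Fin n) (Fin n) ℂ, (∀ i j, ‖C i j‖ < δ) →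
        MatHomotopic f (fun x => g x + C) := by
  obtain ⟨δ, hδ, hnear⟩ := exists_near_matHomotopic hf hd
  -- Half of the tolerance `δ` is spent on the approximation, the other half is kept for the
  -- constant `C`.
  choose g hg hgf using fun i j =>
    exists_smooth_near ⟨fun x => f x i j, hf.matrix_elem i j⟩ (half_pos hδ)
  have hgc : Continuous fun x => Matrix.of fun i j => g i j x :=
    continuous_matrix fun i j => (g i j).continuous
  refine ⟨fun x => Matrix.of fun i j => g i j x, hgc, fun i j => hg i j, δ / 2, half_pos hδ,
    fun C hC => hnear _ (hgc.add continuous_const) fun x i j => ?_⟩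
  have : (Matrix.of (fun i j => g i j x) + C) i j - f x i j = (g i j x - f x i j) + C i j := by
    simp only [Matrix.add_apply, Matrix.of_apply]; ring
  rw [this]
  have h₁ : ‖g i j x - f x i j‖ < δ / 2 := hgf i j x
  exact (norm_add_le _ _).trans_lt (by linarith [hC i j])

end SmoothApproximation

/-! ### Reduction of torus maps into `GL` to their determinant -/

section Reduction

open Matrix unitInterval

/-- The diagonal matrix with entries `1, …, 1, d`. -/
def lastDiag (n : ℕ) (d : ℂ) : Matrix (Fin (n + 1)) (Fin (n + 1)) ℂ :=
  diagonal fun i => if i = Fin.last n then d else 1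

lemma continuous_lastDiag (n : ℕ) : Continuous (lastDiag n) :=
  Continuous.matrix_diagonal (continuous_pi fun i => by split_ifs <;> fun_prop)

lemma det_lastDiag (n : ℕ) (d : ℂ) : (lastDiag n d).det = d := by
  simp [lastDiag, det_diagonal]

/-- The block matrix `[1 r; 0 g]`. -/
def blockOne {n : ℕ} (r : Fin n → ℂ) (g : Matrix (Fin n) (Fin n) ℂ) :
    Matrix (Fin (n + 1)) (Fin (n + 1)) ℂ :=
  Matrix.of (Fin.cons (Fin.cons 1 r) fun i => Fin.cons 0 (g i))

lemma continuous_blockOne {n : ℕ} :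
    Continuous fun q : (Fin n → ℂ) × Matrix (Fin n) (Fin n) ℂ => blockOne q.1 q.2 := by
  refine continuous_matrix fun i j => ?_
  refine Fin.cases ?_ (fun i => ?_) i <;> refine Fin.cases ?_ (fun j => ?_) j <;>
    simp only [blockOne, Matrix.of_apply, Fin.cons_zero, Fin.cons_succ]
  · exact continuous_const
  · fun_prop
  · exact continuous_const
  · exact continuous_snd.matrix_elem i j

lemma det_blockOne {n : ℕ} (r : Fin n → ℂ) (g : Matrix (Fin n) (Fin n) ℂ) :
    (blockOne r g).det = g.det := by
  rw [det_succ_column_zero, Fin.sum_univ_succ]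
  simp [blockOne, Matrix.submatrix]
  rfl

lemma blockOne_lastDiag (n : ℕ) (d : ℂ) : blockOne 0 (lastDiag n d) = lastDiag (n + 1) d := by
  ext i j
  refine Fin.cases ?_ (fun i => ?_) i <;> refine Fin.cases ?_ (fun j => ?_) j <;>
    simp [blockOne, lastDiag, diagonal_apply, Fin.succ_ne_zero, (Fin.succ_ne_zero _).symm,
      ← Fin.succ_last]

lemma eq_blockOne {n : ℕ} (M : Matrix (Fin (n + 1)) (Fin (n + 1)) ℂ)
    (h : ∀ i, M i 0 = if i = 0 then 1 else 0) :
    M = blockOne (fun j => M 0 j.succ) (M.submatrix Fin.succ Fin.succ) := by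
  ext i j
  refine Fin.cases ?_ (fun i => ?_) i <;> refine Fin.cases ?_ (fun j => ?_) j <;>
    simp [blockOne, h, Fin.succ_ne_zero]

/-- Once the first column is `e₀`, the first row can be cleared. -/
lemma matHomotopic_blockOne {K : Type*} [TopologicalSpace K] {n : ℕ}
    {f : K → Matrix (Fin (n + 1)) (Fin (n + 1)) ℂ} (hf : Continuous f) (hd : ∀ x, (f x).det ≠ 0)
    (h : ∀ x i, f x i 0 = if i = 0 then 1 else 0) :
    MatHomotopic f (fun x => blockOne 0 ((f x).submatrix Fin.succ Fin.succ)) := by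
  refine .of_path (fun q => blockOne ((1 - ((q.1 : ℝ) : ℂ)) • fun j => f q.2 0 j.succ)
    ((f q.2).submatrix Fin.succ Fin.succ)) ?_ ?_ ?_ ?_
  · refine continuous_blockOne.comp (Continuous.prodMk ?_ ?_)
    · refine Continuous.smul (f := fun q : I × K => 1 - ((q.1 : ℝ) : ℂ)) (by fun_prop)
        (continuous_pi fun j => ?_)
      exact (hf.comp continuous_snd).matrix_elem _ _
    · exact (hf.comp continuous_snd).matrix_submatrix _ _
  · rintro ⟨s, x⟩
    have := hd x
    rw [eq_blockOne (f x) (h x), det_blockOne] at this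
    rwa [det_blockOne]
  · intro x
    simpa using (eq_blockOne (f x) (h x)).symm
  · intro x
    simp

lemma normSq_add_ne_zero {a b : ℂ} (h : a ≠ 0 ∨ b ≠ 0) :
    ((Complex.normSq a + Complex.normSq b : ℝ) : ℂ) ≠ 0 := by
  intro h2
  have h2 := Complex.ofReal_eq_zero.1 h2
  have h3 := Complex.normSq_nonneg a
  have h4 := Complex.normSq_nonneg b
  rcases h with h' | h'
  · exact h' (Complex.normSq_eq_zero.1 (by linarith))
  · exact h' (Complex.normSq_eq_zero.1 (by linarith))

/-- If the entries `1, 2` of the first column have no common zero, the first column can be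
deformed to `e₀`. -/
lemma exists_matHomotopic_col {K : Type*} [TopologicalSpace K] {n : ℕ}
    {f : K → Matrix (Fin (n + 3)) (Fin (n + 3)) ℂ} (hf : Continuous f) (hd : ∀ x, (f x).det ≠ 0)
    (h : ∀ x, f x 1 0 ≠ 0 ∨ f x 2 0 ≠ 0) :
    ∃ g, MatHomotopic f g ∧ ∀ x i, g x i 0 = if i = 0 then 1 else 0 := by
  have h01 : (1 : Fin (n + 3)) ≠ 0 := by simp
  have h02 : (2 : Fin (n + 3)) ≠ 0 := by
    rw [Ne, Fin.ext_iff, Fin.val_two, Fin.val_zero]; omega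
  let q : K → ℂ := fun x => star (f x 1 0) * f x 1 0 + star (f x 2 0) * f x 2 0
  have hq : ∀ x, q x ≠ 0 := by
    intro x
    have h1 : q x = ((Complex.normSq (f x 1 0) + Complex.normSq (f x 2 0) : ℝ) : ℂ) := by
      simp only [q, Complex.star_def, ← Complex.normSq_eq_conj_mul_self, Complex.ofReal_add]
    rw [h1]
    exact normSq_add_ne_zero (h x)
  have hel : ∀ i j, Continuous fun x => f x i j := fun i j => hf.matrix_elem i j
  have hqc : Continuous q :=
    ((hel 1 0).star.mul (hel 1 0)).add ((hel 2 0).star.mul (hel 2 0))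
  -- `b` is scaled so that it pairs to `1` with the first column. Adding `1 - f x 0 0` times this
  -- combination of rows `1, 2` to row `0` puts a `1` in the corner, and `b ⬝ᵥ a = 0` since the
  -- supports are disjoint.
  let a : K → Fin (n + 3) → ℂ := fun x => Pi.single 0 (1 - f x 0 0)
  let b : K → Fin (n + 3) → ℂ := fun x =>
    Pi.single 1 (star (f x 1 0) / q x) + Pi.single 2 (star (f x 2 0) / q x)
  have hsingle : ∀ (i : Fin (n + 3)) (c : K → ℂ), Continuous c →
      Continuous fun x => (Pi.single i (c x) : Fin (n + 3) → ℂ) := fun i c hc =>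
    (continuous_single i).comp hc
  have h₁ := matHomotopic_rankOne_mul hf hd (a := a) (b := b)
    (hsingle 0 _ (continuous_const.sub (hel 0 0)))
    ((hsingle 1 _ ((hel 1 0).star.div hqc hq)).add (hsingle 2 _ ((hel 2 0).star.div hqc hq)))
    (fun x => by simp [a, b, h02])
  set g : K → Matrix (Fin (n + 3)) (Fin (n + 3)) ℂ :=
    fun x => (1 + vecMulVec (a x) (b x)) * f x with hg
  have hg0 : ∀ x, g x 0 0 = 1 := by
    intro x
    have hbv : (b x ⬝ᵥ fun k => f x k 0) = 1 := by
      simp only [b, add_dotProduct, single_dotProduct]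
      rw [div_mul_eq_mul_div, div_mul_eq_mul_div, ← add_div]
      exact div_self (hq x)
    rw [hg]
    simp only [rankOne_mul_col, hbv, a, Pi.single_eq_same]
    ring
  have hgc := h₁.symm.continuous_left
  have hgd := h₁.symm.det_ne_zero
  -- The corner entry `1` now clears the rest of its column.
  let a' : K → Fin (n + 3) → ℂ := fun x i => if i = 0 then 0 else - g x i 0
  have h₂ := matHomotopic_rankOne_mul hgc hgd (a := a') (b := fun _ => Pi.single 0 1)
    (continuous_pi fun i => by
      by_cases hi : i = 0
      · simp only [a', hi, if_true]; exact continuous_const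
      · simp only [a', hi, if_false]; exact (hgc.matrix_elem i 0).neg) continuous_const
    (fun x => by simp [a'])
  refine ⟨_, h₁.trans h₂, fun x i => ?_⟩
  rw [rankOne_mul_col]
  by_cases hi : i = 0
  · subst hi
    simp [a', hg0]
  · simp [a', hg0, hi]

/-- The matrix of determinant `d` with first column `(a, b)` and orthogonal columns. -/
def orthoMat (a b d : ℂ) : Matrix (Fin 2) (Fin 2) ℂ :=
  !![a, -(d * star b / ((Complex.normSq a + Complex.normSq b : ℝ) : ℂ));
     b, d * star a / ((Complex.normSq a + Complex.normSq b : ℝ) : ℂ)]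

lemma det_orthoMat {a b d : ℂ} (h : a ≠ 0 ∨ b ≠ 0) : (orthoMat a b d).det = d := by
  have h0 := normSq_add_ne_zero h
  rw [orthoMat, det_fin_two_of]
  have h1 : ((Complex.normSq a + Complex.normSq b : ℝ) : ℂ) = star a * a + star b * b := by
    simp only [Complex.star_def, ← Complex.normSq_eq_conj_mul_self, Complex.ofReal_add]
  calc _ = d * ((star a * a + star b * b) /
        ((Complex.normSq a + Complex.normSq b : ℝ) : ℂ)) := by ring
    _ = d := by rw [← h1, div_self h0, mul_one]

lemma continuous_orthoMat {Y : Type*} [TopologicalSpace Y] {a b d : Y → ℂ} (ha : Continuous a)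
    (hb : Continuous b) (hd : Continuous d) (h : ∀ y, a y ≠ 0 ∨ b y ≠ 0) :
    Continuous fun y => orthoMat (a y) (b y) (d y) := by
  have hs : Continuous fun y => ((Complex.normSq (a y) + Complex.normSq (b y) : ℝ) : ℂ) := by
    have := Complex.continuous_normSq
    fun_prop
  have hne : ∀ y, ((Complex.normSq (a y) + Complex.normSq (b y) : ℝ) : ℂ) ≠ 0 :=
    fun y => normSq_add_ne_zero (h y)
  refine continuous_matrix fun i j => ?_
  fin_cases i <;> fin_cases j
  · exact ha
  · exact ((hd.mul hb.star).div hs hne).neg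
  · exact hb
  · exact (hd.mul ha.star).div hs hne

/-- The two matrices share the first column and the determinant. The determinant is affine in the
second column, so it is constant along the segment between them. -/
lemma matHomotopic_orthoMat {K : Type*} [TopologicalSpace K] {f : K → Matrix (Fin 2) (Fin 2) ℂ}
    (hf : Continuous f) (hd : ∀ x, (f x).det ≠ 0) :
    MatHomotopic f fun x => orthoMat (f x 0 0) (f x 1 0) (f x).det := by
  have hcol : ∀ x, f x 0 0 ≠ 0 ∨ f x 1 0 ≠ 0 := by
    intro x
    by_contra! h
    apply hd x
    rw [det_fin_two, h.1, h.2]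
    ring
  have hc := continuous_orthoMat (hf.matrix_elem 0 0) (hf.matrix_elem 1 0) hf.matrix_det hcol
  refine .of_path (fun q => (1 - ((q.1 : ℝ) : ℂ)) • f q.2 +
    ((q.1 : ℝ) : ℂ) • orthoMat (f q.2 0 0) (f q.2 1 0) (f q.2).det) ?_ ?_ ?_ ?_
  · have hc' := hc.comp (continuous_snd (X := I))
    have hf' := hf.comp (continuous_snd (X := I))
    have h1 : Continuous fun q : I × K => ((q.1 : ℝ) : ℂ) := by fun_prop
    exact ((continuous_const.sub h1).smul hf').add (h1.smul hc')
  · rintro ⟨s, x⟩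
    have h1 := det_orthoMat (d := (f x).det) (hcol x)
    suffices h : ((1 - ((s : ℝ) : ℂ)) • f x +
        ((s : ℝ) : ℂ) • orthoMat (f x 0 0) (f x 1 0) (f x).det).det = (f x).det by
      rw [h]; exact hd x
    have h2 : ((1 - ((s : ℝ) : ℂ)) • f x +
        ((s : ℝ) : ℂ) • orthoMat (f x 0 0) (f x 1 0) (f x).det).det =
        (1 - ((s : ℝ) : ℂ)) * (f x).det +
          s * (orthoMat (f x 0 0) (f x 1 0) (f x).det).det := by
      rw [det_fin_two, det_fin_two (orthoMat _ _ _), det_fin_two (f x)]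
      simp [orthoMat]
      ring
    rw [h2, h1]
    ring
  · simp
  · simp

/-- Because `orthoMat` is built from its first column and determinant, it is enough to deform the
column through nonzero vectors. -/
lemma orthoMat_segment {K : Type*} [TopologicalSpace K] {a b a' b' d : K → ℂ} (ha : Continuous a)
    (hb : Continuous b) (ha' : Continuous a') (hb' : Continuous b') (hd : Continuous d)
    (hd0 : ∀ x, d x ≠ 0)
    (h : ∀ (s : I) x, (1 - ((s : ℝ) : ℂ)) * a x + (s : ℝ) * a' x ≠ 0 ∨
      (1 - ((s : ℝ) : ℂ)) * b x + (s : ℝ) * b' x ≠ 0) :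
    MatHomotopic (fun x => orthoMat (a x) (b x) (d x)) fun x => orthoMat (a' x) (b' x) (d x) := by
  refine .of_path (fun q => orthoMat ((1 - ((q.1 : ℝ) : ℂ)) * a q.2 + (q.1 : ℝ) * a' q.2)
    ((1 - ((q.1 : ℝ) : ℂ)) * b q.2 + (q.1 : ℝ) * b' q.2) (d q.2)) ?_ ?_ ?_ ?_
  · exact continuous_orthoMat (by fun_prop) (by fun_prop) (by fun_prop) fun q => h q.1 q.2
  · rintro ⟨s, x⟩
    rw [det_orthoMat (h s x)]
    exact hd0 x
  · simp
  · simp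

lemma surjective_coe_torus (x : UnitAddCircle × UnitAddCircle) :
    ∃ q : ℝ × ℝ, ((q.1 : UnitAddCircle), (q.2 : UnitAddCircle)) = x := by
  obtain ⟨a, b⟩ := x
  obtain ⟨a, rfl⟩ := QuotientAddGroup.mk_surjective a
  obtain ⟨b, rfl⟩ := QuotientAddGroup.mk_surjective b
  exact ⟨(a, b), rfl⟩

lemma finrank_complex_prod : Module.finrank ℝ (ℂ × ℂ) = 4 := by
  rw [Module.finrank_prod, Complex.finrank_real_complex]

/-- The real multiples of the first column form a `C¹` image of `ℝ³` in `ℝ⁴`, so some `w` near `(1,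
0)` is not among them. The segment from the column to `w` then misses `0`, as does the one from `w`
to `(1, 0)`. -/
lemma exists_lastDiag_two {f : UnitAddCircle × UnitAddCircle → Matrix (Fin 2) (Fin 2) ℂ}
    (hf : Continuous f) (hd : ∀ x, (f x).det ≠ 0) :
    ∃ d : UnitAddCircle × UnitAddCircle → ℂ, MatHomotopic f fun x => lastDiag 1 (d x) := by
  obtain ⟨g, hg, hsm, δ, hδ, hfg⟩ := exists_smooth_matHomotopic hf hd
  have hfg := hfg 0 fun i j => by simpa using hδ
  simp only [add_zero] at hfg
  have hgd := hfg.symm.det_ne_zero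
  let Ψ : ℝ × ℝ × ℝ → ℂ × ℂ := fun r =>
    (r.1 * g ((r.2.1 : UnitAddCircle), (r.2.2 : UnitAddCircle)) 0 0,
      r.1 * g ((r.2.1 : UnitAddCircle), (r.2.2 : UnitAddCircle)) 1 0)
  have hΨ : ContDiff ℝ 1 Ψ := by
    have h1 : ContDiff ℝ 1 fun r : ℝ × ℝ × ℝ => (r.1 : ℂ) :=
      Complex.ofRealCLM.contDiff.comp contDiff_fst
    exact (h1.mul ((hsm 0 0).comp contDiff_snd)).prodMk (h1.mul ((hsm 1 0).comp contDiff_snd))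
  have hdense := hΨ.dense_compl_range_of_finrank_lt_finrank (by
    rw [finrank_complex_prod, Module.finrank_prod, Module.finrank_prod, Module.finrank_self]
    norm_num)
  obtain ⟨w, hw, hwd⟩ := Metric.dense_iff.1 hdense (1, 0) 1 one_pos
  have hwd : w ∉ Set.range Ψ := hwd
  have hw1 : ‖w.1 - 1‖ < 1 := by
    have := Metric.mem_ball.1 hw
    rw [dist_eq_norm] at this
    exact (norm_fst_le (w - (1, 0))).trans_lt this
  have hdc := hg.matrix_det
  have hΨ0 : ∀ x : UnitAddCircle × UnitAddCircle, ∀ r : ℝ,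
      ¬ ((r : ℂ) * g x 0 0 = w.1 ∧ (r : ℂ) * g x 1 0 = w.2) := by
    rintro x r ⟨h1, h2⟩
    obtain ⟨q, rfl⟩ := surjective_coe_torus x
    exact hwd ⟨(r, q), Prod.ext h1 h2⟩
  have h1 := orthoMat_segment (hg.matrix_elem 0 0) (hg.matrix_elem 1 0)
    (continuous_const (y := w.1)) (continuous_const (y := w.2)) hdc hgd (by
      intro s x
      by_contra! h
      obtain ⟨h1, h2⟩ := h
      by_cases hs : (s : ℝ) = 0
      · simp only [hs, Complex.ofReal_zero, sub_zero, one_mul, zero_mul, add_zero] at h1 h2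
        apply hgd x
        rw [det_fin_two, h1, h2]
        ring
      · have hs' : ((s : ℝ) : ℂ) ≠ 0 := by exact_mod_cast hs
        -- Solving `(1 - s) • column + s • w = 0` for `w` exhibits `w` as a real multiple of the
        -- column.
        refine hΨ0 x (-(1 - (s : ℝ)) / (s : ℝ)) ⟨?_, ?_⟩
        · push_cast
          field_simp
          linear_combination -h1
        · push_cast
          field_simp
          linear_combination -h2)
  have h2 := orthoMat_segment (K := UnitAddCircle × UnitAddCircle) (continuous_const (y := w.1))
    (continuous_const (y := w.2)) (continuous_const (y := 1)) (continuous_const (y := 0))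
    hdc hgd (by
      intro s x
      left
      intro h
      have h1 : (1 - ((s : ℝ) : ℂ)) * (w.1 - 1) = -1 := by linear_combination h
      have h2 := congrArg norm h1
      rw [norm_neg, norm_one, norm_mul, ← Complex.ofReal_one, ← Complex.ofReal_sub,
        Complex.norm_real, Real.norm_of_nonneg (sub_nonneg.2 s.2.2), Complex.ofReal_one] at h2
      have h3 : (1 - (s : ℝ)) * ‖w.1 - 1‖ ≤ ‖w.1 - 1‖ :=
        mul_le_of_le_one_left (norm_nonneg _) (by linarith [s.2.1])
      linarith)
  refine ⟨fun x => (g x).det, ?_⟩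
  have h3 := (hfg.trans (matHomotopic_orthoMat hg hgd)).trans (h1.trans h2)
  convert h3 using 2 with x
  ext i j
  fin_cases i <;> fin_cases j <;> simp [lastDiag, orthoMat]

/-- Every map from the torus to `GL` is homotopic to one with values `diag(1, …, 1, d)`. -/
lemma exists_lastDiag (n : ℕ)
    {f : UnitAddCircle × UnitAddCircle → Matrix (Fin (n + 1)) (Fin (n + 1)) ℂ}
    (hf : Continuous f) (hd : ∀ x, (f x).det ≠ 0) :
    ∃ d : UnitAddCircle × UnitAddCircle → ℂ, MatHomotopic f fun x => lastDiag n (d x) := by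
  induction n with
  | zero =>
    refine ⟨fun x => f x 0 0, ?_⟩
    convert MatHomotopic.refl hf hd using 2 with x
    ext i j
    fin_cases i; fin_cases j
    simp [lastDiag]
  | succ n ih =>
    -- In size 2 there are no two entries below the corner, so the column argument does not apply.
    rcases n with _ | n
    · exact exists_lastDiag_two hf hd
    obtain ⟨g, hg, hsm, δ, hδ, hfg⟩ := exists_smooth_matHomotopic hf hd
    -- Subtracting a small value `w` outside the range of this map leaves the two entries without a
    -- common zero.
    let Ψ : ℝ × ℝ → ℂ × ℂ := fun r =>
      (g ((r.1 : UnitAddCircle), (r.2 : UnitAddCircle)) 1 0,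
        g ((r.1 : UnitAddCircle), (r.2 : UnitAddCircle)) 2 0)
    have hΨ : ContDiff ℝ 1 Ψ := (hsm 1 0).prodMk (hsm 2 0)
    have hdense := hΨ.dense_compl_range_of_finrank_lt_finrank (by
      rw [finrank_complex_prod, Module.finrank_prod, Module.finrank_self]
      norm_num)
    obtain ⟨w, hw, hwd⟩ := Metric.dense_iff.1 hdense 0 δ hδ
    have hwd : w ∉ Set.range Ψ := hwd
    have hw := mem_ball_zero_iff.1 hw
    have hne : (2 : Fin (n + 3)) ≠ 1 := by
      rw [Ne, Fin.ext_iff, Fin.val_two, Fin.val_one]; omega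
    have hfg := hfg (Matrix.of fun i j => if i = 1 then -w.1 else if i = 2 then -w.2 else 0)
      fun i j => by
        simp only [Matrix.of_apply]
        split_ifs
        · rw [norm_neg]; exact (norm_fst_le w).trans_lt hw
        · rw [norm_neg]; exact (norm_snd_le w).trans_lt hw
        · simpa using hδ
    obtain ⟨k, hgk, hk⟩ := exists_matHomotopic_col hfg.symm.continuous_left hfg.symm.det_ne_zero (by
      intro x
      by_contra! h
      obtain ⟨h1, h2⟩ := h
      simp only [Matrix.add_apply, Matrix.of_apply, if_true, hne, if_false, ← sub_eq_add_neg,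
        sub_eq_zero] at h1 h2
      obtain ⟨q, rfl⟩ := surjective_coe_torus x
      exact hwd ⟨q, Prod.ext h1 h2⟩)
    have hkb := matHomotopic_blockOne hgk.symm.continuous_left hgk.symm.det_ne_zero hk
    obtain ⟨d, hd'⟩ := ih (hgk.symm.continuous_left.matrix_submatrix Fin.succ Fin.succ)
      (fun x => by
        have := hkb.symm.det_ne_zero x
        rwa [det_blockOne] at this)
    refine ⟨d, (hfg.trans hgk).trans (hkb.trans ?_)⟩
    have := hd'.map (fun M => blockOne 0 M)
      (continuous_blockOne.comp (continuous_const.prodMk continuous_id))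
      (fun M hM => by rwa [det_blockOne])
    simpa only [blockOne_lastDiag] using this

/-- Every map from the torus to `GL` is determined up to homotopy by its determinant. -/
theorem matHomotopic_lastDiag_det (n : ℕ)
    {f : UnitAddCircle × UnitAddCircle → Matrix (Fin (n + 1)) (Fin (n + 1)) ℂ}
    (hf : Continuous f) (hd : ∀ x, (f x).det ≠ 0) :
    MatHomotopic f fun x => lastDiag n (f x).det := by
  obtain ⟨d, h⟩ := exists_lastDiag n hf hd
  -- Applying `M ↦ diag(1, …, 1, det M)` to the homotopy links the unknown `d` to the determinant of
  -- `f`.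
  have h' := h.map (fun M => lastDiag n M.det) ((continuous_lastDiag n).comp
    (Continuous.matrix_det continuous_id)) (fun M hM => by rwa [det_lastDiag])
  simp only [det_lastDiag] at h'
  exact h.trans h'.symm

end Reduction

/-! ### Descent of doubly periodic functions -/

section TorusDescent

lemma eq_of_coe_eq_of_periodic {Z : Type*} {p T : ℝ} {F : ℝ → ℝ → Z}
    (hp : ∀ x t, F (x + p) t = F x t) (hT : ∀ x t, F x (t + T) = F x t) {x x' t t' : ℝ}
    (hx : (x : AddCircle p) = x') (ht : (t : AddCircle T) = t') : F x t = F x' t' := by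
  have h1 : ∀ s, Function.Periodic (fun y => F y s) p := fun s y => hp y s
  have h2 : Function.Periodic (F x') T := fun s => hT x' s
  rw [QuotientAddGroup.eq, AddSubgroup.mem_zmultiples_iff] at hx ht
  obtain ⟨m, hm⟩ := hx
  obtain ⟨k, hk⟩ := ht
  have hx' : x' = x + m • p := by rw [hm]; ring
  have ht' : t' = t + k • T := by rw [hk]; ring
  rw [ht', (h2.zsmul k) t, hx']
  exact (((h1 t).zsmul m) x).symm

/-- Doubly periodic functions descend to the torus. -/
lemma exists_torus_lift {Z : Type*} [TopologicalSpace Z] {p T : ℝ} {F : ℝ → ℝ → Z}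
    (hF : Continuous fun q : ℝ × ℝ => F q.1 q.2)
    (hp : ∀ x t, F (x + p) t = F x t) (hT : ∀ x t, F x (t + T) = F x t) :
    ∃ G : C(AddCircle p × AddCircle T, Z), ∀ x t : ℝ, G ((x : AddCircle p), (t : AddCircle T)) =
      F x t := by
  -- Openness matters: a product of quotient maps need not be a quotient map.
  have hπ : IsOpenQuotientMap (Prod.map ((↑) : ℝ → AddCircle p) ((↑) : ℝ → AddCircle T)) :=
    QuotientAddGroup.isOpenQuotientMap_mk.prodMap QuotientAddGroup.isOpenQuotientMap_mk
  let g : AddCircle p × AddCircle T → Z := fun q =>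
    F (Function.surjInv hπ.surjective q).1 (Function.surjInv hπ.surjective q).2
  have hg : ∀ x t : ℝ, g ((x : AddCircle p), (t : AddCircle T)) = F x t := by
    intro x t
    have h := Function.surjInv_eq hπ.surjective ((x : AddCircle p), (t : AddCircle T))
    exact eq_of_coe_eq_of_periodic hp hT (congrArg Prod.fst h) (congrArg Prod.snd h)
  refine ⟨⟨g, hπ.isQuotientMap.continuous_iff.2 ?_⟩, hg⟩
  convert hF using 2 with q
  exact hg q.1 q.2

end TorusDescent

/-! ### Logarithms and the winding number of the determinant -/

section Winding

open unitInterval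

/-- A continuous function whose exponential is constant is constant. -/
lemma eq_of_exp_eq {Y : Type*} [TopologicalSpace Y] [PreconnectedSpace Y] {ψ : Y → ℂ}
    (hψ : Continuous ψ) {c : ℂ} (h : ∀ y, Complex.exp (ψ y) = c) (y y' : Y) : ψ y = ψ y' :=
  Complex.isCoveringMap_exp.const_of_comp hψ
    (fun a b => Subtype.ext ((h a).trans (h b).symm)) y y'

lemma exists_continuous_log {d : ℝ × ℝ → ℂ} (hd : Continuous d) (h0 : ∀ q, d q ≠ 0) :
    ∃ φ : ℝ × ℝ → ℂ, Continuous φ ∧ ∀ q, Complex.exp (φ q) = d q := by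
  obtain ⟨φ, hφ, h⟩ := Complex.exists_continuousOn_eqOn_exp_comp (U := (Set.univ : Set (ℝ × ℝ)))
    (by
      have := (convex_univ (𝕜 := ℝ) (E := ℝ × ℝ)).contractibleSpace Set.univ_nonempty
      exact SimplyConnectedSpace.ofContractible _) isOpen_univ hd.continuousOn (by simpa using h0)
  exact ⟨φ, continuousOn_univ.1 hφ, fun q => h (Set.mem_univ q)⟩

/-- The degree of a class of loops in the circle. -/
def circleDegree (c : FundamentalGroup Circle 1) : ℤ :=
  -- The lift starts at `0` and ends in `2πℤ`, so `round` only converts an integral real number to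
  -- `ℤ`.
  round ((Circle.isCoveringMap_exp.monodromy (FundamentalGroup.toPath c)
    ⟨0, by simp⟩ : ℝ) / (2 * Real.pi))

/-- Uniqueness of path lifting: `θ` is the lift of `w` that starts at `0`. -/
lemma circleDegree_loopClass {w : Path (1 : Circle) 1} {θ : ℝ → ℝ} (hθ : Continuous θ)
    (h0 : θ 0 = 0) {k : ℤ} (h1 : θ 1 = 2 * Real.pi * k) (hw : ∀ s : I, Circle.exp (θ s) = w s) :
    circleDegree (loopClass w) = k := by
  have hw0 : (w : C(I, Circle)) 0 = Circle.exp 0 := by simp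
  have h : (fun s : I => θ s) = Circle.isCoveringMap_exp.liftPath w 0 hw0 :=
    (Circle.isCoveringMap_exp.eq_liftPath_iff hw0).2
      ⟨by fun_prop, funext hw, by simpa using h0⟩
  have h2 : (Circle.isCoveringMap_exp.monodromy (FundamentalGroup.toPath (loopClass w))
    ⟨0, by simp⟩ : ℝ) = Circle.isCoveringMap_exp.liftPath w 0 hw0 1 := rfl
  rw [circleDegree, h2, ← h]
  simp only [Set.Icc.coe_one, h1]
  rw [mul_div_cancel_left₀ _ (by positivity), round_intCast]

/-- A logarithm `φ` of `d` on the plane changes by a constant over each period. In the first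
variable the constant is `0`, as `d = 1` on the circle `t = 0`; in the second it is `2πik`. Hence
`2πikt - φ` is doubly periodic. -/
lemma exists_log_ratio {d : UnitAddCircle × UnitAddCircle → ℂ} (hd : Continuous d)
    (h0 : ∀ q, d q ≠ 0) (h1 : ∀ x, d (x, 0) = 1) {w : Path (1 : Circle) 1}
    (hw : ∀ s : I, (w s : ℂ) = d (0, ((s : ℝ) : UnitAddCircle)) /
      (‖d (0, ((s : ℝ) : UnitAddCircle))‖ : ℂ)) :
    ∃ ψ : C(UnitAddCircle × UnitAddCircle, ℂ),
      ∀ q, fourier (circleDegree (loopClass w)) q.2 = d q * Complex.exp (ψ q) := by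
  obtain ⟨φ₀, hφ₀, hexp₀⟩ := exists_continuous_log
    (d := fun q : ℝ × ℝ => d ((q.1 : UnitAddCircle), (q.2 : UnitAddCircle)))
    (hd.comp (by fun_prop)) fun q => h0 _
  let φ : ℝ → ℝ → ℂ := fun x t => φ₀ (x, t) - φ₀ (0, 0)
  have hφ : Continuous fun q : ℝ × ℝ => φ q.1 q.2 := by fun_prop
  have hexp : ∀ x t : ℝ, Complex.exp (φ x t) = d ((x : UnitAddCircle), (t : UnitAddCircle)) := by
    intro x t
    have h00 := hexp₀ (0, 0)
    simp only [AddCircle.coe_zero, h1] at h00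
    simp only [φ, Complex.exp_sub, h00, hexp₀, div_one]
  have hφ0 : ∀ x, φ x 0 = 0 := by
    intro x
    have := eq_of_exp_eq (ψ := fun x => φ x 0) (c := 1) (by fun_prop)
      (fun y => by rw [hexp]; simp [h1]) x 0
    simpa [φ] using this
  have hone : ((1 : ℝ) : UnitAddCircle) = 0 := AddCircle.coe_period 1
  have hper : ∀ x t, φ (x + 1) t = φ x t := by
    intro x t
    have := eq_of_exp_eq (ψ := fun q : ℝ × ℝ => φ (q.1 + 1) q.2 - φ q.1 q.2) (c := 1)
      (by fun_prop) (fun q => by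
        rw [Complex.exp_sub, hexp, hexp, AddCircle.coe_add, hone, add_zero]
        exact div_self (h0 _)) (x, t) (0, 0)
    simp only [hφ0, sub_self] at this
    exact sub_eq_zero.1 this
  have hexp1 : Complex.exp (φ 0 1) = 1 := by
    rw [hexp, hone, h1]
  obtain ⟨k, hk⟩ := Complex.exp_eq_one_iff.1 hexp1
  have hper' : ∀ x t, φ x (t + 1) = φ x t + k * (2 * Real.pi * Complex.I) := by
    intro x t
    have := eq_of_exp_eq (ψ := fun q : ℝ × ℝ => φ q.1 (q.2 + 1) - φ q.1 q.2) (c := 1)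
      (by fun_prop) (fun q => by
        rw [Complex.exp_sub, hexp, hexp, AddCircle.coe_add, hone, add_zero]
        exact div_self (h0 _)) (x, t) (0, 0)
    simp only [hφ0, zero_add, hk, sub_zero] at this
    linear_combination this
  have hdeg : circleDegree (loopClass w) = k := by
    -- Dividing by the modulus removes the real part of the logarithm, so its imaginary part lifts
    -- `w`.
    refine circleDegree_loopClass (θ := fun t => (φ 0 t).im)
      (Complex.continuous_im.comp (by fun_prop)) (by simp [hφ0]) ?_ ?_
    · simp only [hk]
      simp [mul_comm]
    · intro s
      refine Subtype.ext ?_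
      have h2 := hw s
      have h3 := hexp 0 s
      rw [AddCircle.coe_zero] at h3
      rw [← h3, Complex.norm_exp] at h2
      refine Eq.trans ?_ h2.symm
      rw [Circle.coe_exp, Complex.ofReal_exp, ← Complex.exp_sub]
      congr 1
      apply Complex.ext <;> simp
  obtain ⟨ψ, hψ⟩ := exists_torus_lift (p := 1) (T := 1)
    (F := fun x t => k * (2 * Real.pi * Complex.I) * t - φ x t) (by fun_prop)
    (fun x t => by simp only [hper]) (fun x t => by simp only [hper']; push_cast; ring)
  refine ⟨ψ, fun q => ?_⟩
  obtain ⟨⟨x, t⟩, rfl⟩ := surjective_coe_torus q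
  rw [hψ, hdeg, ← hexp, ← Complex.exp_add, fourier_coe_apply]
  congr 1
  push_cast
  ring

open Matrix in
/-- A map from the torus to `GL` which is based along one circle is determined up to homotopy by
the degree of its determinant along the other circle. -/
theorem matHomotopic_fourier (n : ℕ)
    {f : UnitAddCircle × UnitAddCircle → Matrix (Fin (n + 1)) (Fin (n + 1)) ℂ} (hf : Continuous f)
    (hd : ∀ q, (f q).det ≠ 0) (h1 : ∀ x, f (x, 0) = 1) {w : Path (1 : Circle) 1}
    (hw : ∀ s : I, (w s : ℂ) = (f (0, ((s : ℝ) : UnitAddCircle))).det /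
      (‖(f (0, ((s : ℝ) : UnitAddCircle))).det‖ : ℂ)) :
    MatHomotopic f fun q => lastDiag n (fourier (circleDegree (loopClass w)) q.2) := by
  obtain ⟨ψ, hψ⟩ := exists_log_ratio hf.matrix_det hd (fun x => by rw [h1, det_one]) hw
  refine (matHomotopic_lastDiag_det n hf hd).trans ?_
  refine .of_path (fun q => lastDiag n ((f q.2).det * Complex.exp (((q.1 : ℝ) : ℂ) * ψ q.2)))
    ((continuous_lastDiag n).comp ?_) (fun q => ?_) (fun x => ?_) (fun x => ?_)
  · have h2 := hf.matrix_det.comp (continuous_snd (X := I))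
    exact h2.mul (by fun_prop)
  · rw [det_lastDiag]
    exact mul_ne_zero (hd _) (Complex.exp_ne_zero _)
  · simp
  · simp [hψ]

/-- The map of degree `k` in the second variable, in the last diagonal entry. -/
def standardTorusMap (n : ℕ) (k : ℤ) :
    C(UnitAddCircle × UnitAddCircle, Matrix.GeneralLinearGroup (Fin (n + 1)) ℂ) :=
  toGLMap (fun q => lastDiag n (fourier k q.2))
    ((continuous_lastDiag n).comp (by fun_prop)) fun q => by
      rw [det_lastDiag, fourier_apply]
      exact Circle.coe_ne_zero _

end Winding

variable {N : ℕ}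

/-! ### Uniqueness, invertibility and parameter dependence for linear equations -/

section LinearODE

open Set Filter Topology
open scoped Matrix.Norms.Operator

lemma linearODE_unique {A Y Z : ℝ → Matrix (Fin N) (Fin N) ℂ} {C : ℝ} (hA : ∀ t, ‖A t‖ ≤ C)
    (hY : ∀ t, HasDerivAt Y (A t * Y t) t) (hZ : ∀ t, HasDerivAt Z (A t * Z t) t) {t₀ : ℝ}
    (h : Y t₀ = Z t₀) : Y = Z := by
  refine ODE_solution_unique_univ (v := fun t M => A t * M) (s := fun _ => univ)
    (K := C.toNNReal) (fun t => LipschitzOnWith.of_dist_le_mul fun M _ M' _ => ?_)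
    (fun t => ⟨hY t, trivial⟩) (fun t => ⟨hZ t, trivial⟩) h
  rw [dist_eq_norm, dist_eq_norm, ← mul_sub]
  exact (norm_mul_le _ _).trans
    (mul_le_mul_of_nonneg_right ((hA t).trans (Real.le_coe_toNNReal C)) (norm_nonneg _))

lemma IsFundamentalSolution.hasDerivAt {A X : ℝ → ℝ → Matrix (Fin N) (Fin N) ℂ}
    (h : IsFundamentalSolution A X) (γ t : ℝ) : HasDerivAt (X γ) (A γ t * X γ t) t :=
  hasDerivAt_pi.2 fun i => hasDerivAt_pi.2 fun j => h.2 γ t i j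

/-- A kernel vector `v` at one time gives a solution `X v` vanishing there, hence always; at time
`0` this forces `v = 0`. -/
lemma IsFundamentalSolution.det_ne_zero {A X : ℝ → ℝ → Matrix (Fin N) (Fin N) ℂ}
    (h : IsFundamentalSolution A X) {C : ℝ} (hA : ∀ γ t, ‖A γ t‖ ≤ C) (γ t : ℝ) :
    (X γ t).det ≠ 0 := by
  intro h0
  obtain ⟨v, hv, hXv⟩ := Matrix.exists_mulVec_eq_zero_iff.2 h0
  let B : Matrix (Fin N) (Fin N) ℂ := Matrix.of fun i _ => v i
  have h1 : (fun s => X γ s * B) = fun _ => 0 := by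
    refine linearODE_unique (hA γ) (fun s => ?_) (fun s => ?_) (t₀ := t) ?_
    · rw [← mul_assoc]
      exact (h.hasDerivAt γ s).mul_const B
    · rw [mul_zero]
      exact hasDerivAt_const _ _
    · ext i j
      exact congrFun hXv i
  have h2 : B = 0 := by simpa [h.1] using congrFun h1 0
  refine hv (funext fun i => ?_)
  exact congrFun (congrFun h2 i) i

/-- Grönwall for `X γ - X γ₀`, whose equation has inhomogeneity `(A γ - A γ₀) X γ₀`, uniformly small
on `[0, R]` when `γ` is near `γ₀`. -/
lemma IsFundamentalSolution.eventually_dist_lt {A X : ℝ → ℝ → Matrix (Fin N) (Fin N) ℂ}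
    (h : IsFundamentalSolution A X) {C : ℝ} (hA : ∀ γ t, ‖A γ t‖ ≤ C)
    (hAc : Continuous fun q : ℝ × ℝ => A q.1 q.2) (γ₀ R : ℝ) :
    ∀ ε > 0, ∀ᶠ γ in 𝓝 γ₀, ∀ t ∈ Icc 0 R, dist (X γ₀ t) (X γ t) < ε := by
  have hC : 0 ≤ C := (norm_nonneg _).trans (hA 0 0)
  have hunif : TendstoUniformlyOn A (A γ₀) (𝓝 γ₀) (Icc 0 R) := by
    let A' : C(ℝ, C(ℝ, Matrix (Fin N) (Fin N) ℂ)) := ContinuousMap.curry ⟨_, hAc⟩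
    exact ContinuousMap.tendsto_iff_forall_isCompact_tendstoUniformlyOn.1 (A'.continuous.tendsto γ₀)
      (Icc 0 R) isCompact_Icc
  have hcont : ∀ γ, Continuous (X γ) := fun γ =>
    continuous_iff_continuousAt.2 fun t => (h.hasDerivAt γ t).continuousAt
  obtain ⟨M, hM⟩ := (isCompact_Icc (a := (0 : ℝ)) (b := R)).exists_bound_of_continuousOn
    (hcont γ₀).continuousOn
  replace hunif := Metric.tendstoUniformlyOn_iff.1 hunif
  intro ε hε
  have hlim : Tendsto (fun e => gronwallBound 0 C (e * M) R) (𝓝 0) (𝓝 0) := by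
    have h1 : Continuous fun e => gronwallBound 0 C (e * M) R :=
      (gronwallBound_continuous_ε 0 C R).comp (by fun_prop)
    have h2 := h1.tendsto 0
    rwa [zero_mul, gronwallBound_ε0_δ0] at h2
  have hev : ∀ᶠ e : ℝ in 𝓝[>] 0, gronwallBound 0 C (e * M) R < ε ∧ 0 < e :=
    ((hlim.eventually_lt_const hε).filter_mono nhdsWithin_le_nhds).and self_mem_nhdsWithin
  obtain ⟨e, he, he0⟩ := hev.exists
  filter_upwards [hunif e he0] with γ hγ t ht
  have hM0 : 0 ≤ M := (norm_nonneg _).trans (hM t ht)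
  rw [dist_comm, dist_eq_norm]
  have hg := norm_le_gronwallBound_of_norm_deriv_right_le (f := fun s => X γ s - X γ₀ s)
    (f' := fun s => A γ s * X γ s - A γ₀ s * X γ₀ s) (δ := 0) (K := C) (ε := e * M) (a := 0)
    (b := R) ((hcont γ).sub (hcont γ₀)).continuousOn
    (fun s _ => ((h.hasDerivAt γ s).sub (h.hasDerivAt γ₀ s)).hasDerivWithinAt)
    (by simp [h.1]) (fun s hs => by
      have hs' : s ∈ Icc 0 R := Ico_subset_Icc_self hs
      have h1 : A γ s * X γ s - A γ₀ s * X γ₀ s =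
          A γ s * (X γ s - X γ₀ s) + (A γ s - A γ₀ s) * X γ₀ s := by noncomm_ring
      rw [h1]
      refine (norm_add_le _ _).trans (add_le_add ?_ ?_)
      · exact (norm_mul_le _ _).trans (mul_le_mul_of_nonneg_right (hA γ s) (norm_nonneg _))
      · refine (norm_mul_le _ _).trans (mul_le_mul ?_ (hM s hs') (norm_nonneg _) he0.le)
        rw [← dist_eq_norm, dist_comm]
        exact (hγ s hs').le) t ht
  refine hg.trans_lt (lt_of_le_of_lt ?_ he)
  exact gronwallBound_mono le_rfl (mul_nonneg he0.le hM0) hC (by simpa using ht.2)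

lemma IsFundamentalSolution.continuousAt {A X : ℝ → ℝ → Matrix (Fin N) (Fin N) ℂ}
    (h : IsFundamentalSolution A X) {C : ℝ} (hA : ∀ γ t, ‖A γ t‖ ≤ C)
    (hAc : Continuous fun q : ℝ × ℝ => A q.1 q.2) (γ₀ : ℝ) {t₀ : ℝ} (ht₀ : 0 < t₀) :
    ContinuousAt (fun q : ℝ × ℝ => X q.1 q.2) (γ₀, t₀) := by
  have hu := h.eventually_dist_lt hA hAc γ₀ (t₀ + 1)
  have hc := (h.hasDerivAt γ₀ t₀).continuousAt
  rw [ContinuousAt, nhds_prod_eq]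
  refine Metric.tendsto_nhds.2 ?_
  intro ε hε
  have h1 : ∀ᶠ t in 𝓝 t₀, dist (X γ₀ t) (X γ₀ t₀) < ε / 2 ∧ t ∈ Icc 0 (t₀ + 1) :=
    (Metric.tendsto_nhds.1 hc _ (half_pos hε)).and (Icc_mem_nhds ht₀ (by linarith))
  filter_upwards [(hu _ (half_pos hε)).prod_mk h1] with q hq
  have h2 := hq.1 q.2 hq.2.2
  rw [dist_comm] at h2
  linarith [dist_triangle (X q.1 q.2) (X γ₀ q.2) (X γ₀ t₀), hq.2.1]

end LinearODE

/-! ### Eigenvector frames -/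

section Frames

open Matrix

/-- The matrix whose columns are the given vectors. -/
def colMatrix (v : Fin N → Fin N → ℂ) : Matrix (Fin N) (Fin N) ℂ :=
  Matrix.of fun i n => v n i

lemma det_colMatrix_ne_zero {η : Fin N → ℙ ℂ (Fin N → ℂ)} (hη : ⨆ n, (η n).submodule = ⊤)
    {v : Fin N → Fin N → ℂ} (hv : ∀ n, ∃ h : v n ≠ 0, η n = Projectivization.mk ℂ (v n) h) :
    (colMatrix v).det ≠ 0 := by
  have hsub : ∀ n, (η n).submodule = Submodule.span ℂ {v n} := by
    intro n
    obtain ⟨h, e⟩ := hv n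
    rw [e, Projectivization.submodule_mk]
  have hspan : ⊤ ≤ Submodule.span ℂ (Set.range v) := by
    rw [← hη, Submodule.span_range_eq_iSup]
    exact iSup_mono fun n => (hsub n).le
  have hli : LinearIndependent ℂ v :=
    linearIndependent_of_top_le_span_of_card_eq_finrank hspan (by simp)
  have h1 : IsUnit (colMatrix v) := linearIndependent_cols_iff_isUnit.1 hli
  exact ((isUnit_iff_isUnit_det _).1 h1).ne_zero

lemma colMatrix_mul_diagonal_apply (v : Fin N → Fin N → ℂ) (c : Fin N → ℂ) :
    colMatrix v * diagonal c = colMatrix fun n => c n • v n := by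
  ext i n
  simp [colMatrix, mul_comm]

/-- The exponent matrix can be computed with any vectors that span the lines. -/
lemma exponentMatrix_eq {μ : Fin N → ℝ → ℂ} {η : Fin N → ℝ → ℙ ℂ (Fin N → ℂ)} {γ : ℝ}
    {v : Fin N → Fin N → ℂ} (hv : ∀ n, ∃ h : v n ≠ 0, η n γ = Projectivization.mk ℂ (v n) h) :
    exponentMatrix μ η γ =
      colMatrix v * diagonal (fun n => μ n γ) * (colMatrix v)⁻¹ := by
  have hc : ∀ n, ∃ c : ℂˣ, c • v n = (η n γ).rep := by
    intro n
    obtain ⟨h, e⟩ := hv n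
    rw [e]
    exact (Projectivization.mk_eq_mk_iff ℂ _ _ (Projectivization.rep_nonzero _) h).1
      (Projectivization.mk_rep _)
  choose c hc using hc
  -- Rescaling the columns multiplies on the right by a diagonal matrix, which commutes with the
  -- diagonal of exponents and cancels.
  have hV : (Matrix.of fun i n => (η n γ).rep i) = colMatrix v * diagonal fun n => (c n : ℂ) := by
    rw [colMatrix_mul_diagonal_apply]
    ext i n
    simp [colMatrix, ← hc, Units.smul_def]
  have hu : (diagonal fun n => (c n : ℂ)) * diagonal (fun n => (c n : ℂ)⁻¹) = 1 := by
    rw [diagonal_mul_diagonal, ← diagonal_one]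
    congr 1
    funext n
    simp
  rw [exponentMatrix, hV, Matrix.mul_inv_rev, inv_eq_right_inv hu]
  simp only [Matrix.mul_assoc]
  congr 1
  simp only [← Matrix.mul_assoc]
  congr 1
  rw [diagonal_mul_diagonal, diagonal_mul_diagonal]
  congr 1
  funext n
  rw [mul_right_comm, mul_inv_cancel₀ (c n).ne_zero, one_mul]

end Frames

/-! ### Floquet theory: continuity and time periodicity of `P` -/

namespace ParamSystem

open Set Filter Topology Matrix
open scoped Matrix.Norms.Operator

variable (S : ParamSystem N)

lemma continuous_A : Continuous fun q : ℝ × ℝ => S.A q.1 q.2 :=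
  continuous_matrix fun i j => (S.contDiff_A i j).continuous

/-- Double periodicity makes `A` a continuous function on a compact torus. -/
lemma exists_bound_A : ∃ C : ℝ, ∀ γ t, ‖S.A γ t‖ ≤ C := by
  have := Fact.mk S.ℓ_pos
  have := Fact.mk S.T_pos
  obtain ⟨G, hG⟩ := exists_torus_lift S.continuous_A (fun γ t => S.periodic_param γ t)
    S.periodic_time
  obtain ⟨C, hC⟩ :=
    (isCompact_univ (X := AddCircle S.ℓ × AddCircle S.T)).exists_bound_of_continuousOn
    G.continuous.continuousOn
  exact ⟨C, fun γ t => by rw [← hG]; exact hC _ trivial⟩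

lemma det_X_ne_zero (γ t : ℝ) : (S.X γ t).det ≠ 0 := by
  obtain ⟨C, hC⟩ := S.exists_bound_A
  exact S.fundamental.det_ne_zero hC γ t

lemma X_param_periodic {l : ℝ} (hl : l ∈ AddSubgroup.zmultiples S.ℓ) (γ : ℝ) :
    S.X (γ + l) = S.X γ := by
  obtain ⟨C, hC⟩ := S.exists_bound_A
  obtain ⟨k, rfl⟩ := AddSubgroup.mem_zmultiples_iff.1 hl
  have hA : ∀ t, S.A (γ + k • S.ℓ) t = S.A γ t := fun t =>
    (Function.Periodic.zsmul (f := fun γ => S.A γ t) (fun γ => S.periodic_param γ t) k) γ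
  refine linearODE_unique (hC γ) (fun t => ?_) (S.fundamental.hasDerivAt γ) (t₀ := 0) ?_
  · rw [← hA]
    exact S.fundamental.hasDerivAt _ t
  · rw [S.fundamental.1, S.fundamental.1]

lemma X_add_T (γ t : ℝ) : S.X γ (t + S.T) = S.X γ t * S.X γ S.T := by
  obtain ⟨C, hC⟩ := S.exists_bound_A
  refine congrFun (linearODE_unique (Y := fun t => S.X γ (t + S.T))
    (Z := fun t => S.X γ t * S.X γ S.T) (hC γ) (fun t => ?_) (fun t => ?_) (t₀ := 0) ?_) t
  · rw [← S.periodic_time γ t]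
    exact (S.fundamental.hasDerivAt γ (t + S.T)).comp_add_const t S.T
  · rw [← mul_assoc]
    exact (S.fundamental.hasDerivAt γ t).mul_const _
  · simp [S.fundamental.1]

lemma span_η (γ : ℝ) : ⨆ n, (S.η n γ).submodule = ⊤ := (S.diag.2.2 γ trivial).2

/-- The exponent matrix. -/
abbrev F (γ : ℝ) : Matrix (Fin N) (Fin N) ℂ := exponentMatrix S.μ S.η γ

/-- The representatives `rep` in the definition need not vary continuously, so `F` is recomputed
near each point with a local `C¹` frame. -/
lemma continuous_F : Continuous S.F := by
  refine continuous_iff_continuousAt.2 fun γ₀ => ?_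
  choose U hU hγU v hv hη using fun n => S.diag.2.1 n γ₀ trivial
  have hmem : ∀ᶠ γ in 𝓝 γ₀, ∀ n, γ ∈ U n :=
    eventually_all.2 fun n => (hU n).mem_nhds (hγU n)
  have hvc : ∀ n, ContinuousAt (v n) γ₀ := fun n =>
    (hv n).continuousOn.continuousAt (by simpa using (hU n).mem_nhds (hγU n))
  have hF : (fun γ => colMatrix (fun n => v n γ) * diagonal (fun n => S.μ n γ) *
      (colMatrix fun n => v n γ)⁻¹) =ᶠ[𝓝 γ₀] S.F := by
    filter_upwards [hmem] with γ hγ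
    exact (exponentMatrix_eq fun n => hη n γ ⟨hγ n, trivial⟩).symm
  have hV : ContinuousAt (fun γ => colMatrix fun n => v n γ) γ₀ :=
    continuousAt_pi.2 fun i => continuousAt_pi.2 fun n => continuousAt_pi.1 (hvc n) i
  have hD : Continuous fun γ => diagonal fun n => S.μ n γ :=
    Continuous.matrix_diagonal (continuous_pi fun n => (S.contDiff_μ n).continuous)
  have hdet := det_colMatrix_ne_zero (S.span_η γ₀) (v := fun n => v n γ₀)
    fun n => hη n γ₀ ⟨hγU n, trivial⟩
  have hinv : ContinuousAt (fun γ => (colMatrix fun n => v n γ)⁻¹) γ₀ :=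
    (continuousAt_matrix_inv _ (by simpa using continuousAt_inv₀ hdet)).comp hV
  exact ((hV.mul hD.continuousAt).mul hinv).congr hF

lemma exp_F (γ : ℝ) : NormedSpace.exp ((S.T : ℂ) • S.F γ) = S.X γ S.T := by
  have hv : ∀ n, ∃ h : (S.η n γ).rep ≠ 0, S.η n γ = Projectivization.mk ℂ (S.η n γ).rep h :=
    fun n => ⟨Projectivization.rep_nonzero _, (Projectivization.mk_rep _).symm⟩
  set V := colMatrix fun n => (S.η n γ).rep with hV
  have hu : IsUnit V := (isUnit_iff_isUnit_det _).2
    (det_colMatrix_ne_zero (S.span_η γ) hv).isUnit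
  have hX : S.X γ S.T * V = V * diagonal fun n => S.lam n γ := by
    rw [hV, colMatrix_mul_diagonal_apply]
    ext i n
    have h := (S.diag.2.2 γ trivial).1 n (S.η n γ).rep (by
      rw [Projectivization.submodule_eq]
      exact Submodule.mem_span_singleton_self _)
    exact congrFun h i
  have hF : (S.T : ℂ) • S.F γ = V * diagonal (fun n => (S.T : ℂ) * S.μ n γ) * V⁻¹ := by
    rw [F, exponentMatrix_eq hv, ← Matrix.smul_mul, ← Matrix.mul_smul, ← diagonal_smul]
    rfl
  have hexp : NormedSpace.exp (fun n => (S.T : ℂ) * S.μ n γ) = fun n => S.lam n γ := by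
    funext n
    rw [Pi.coe_exp, ← Complex.exp_eq_exp_ℂ, S.exp_μ]
  rw [hF, Matrix.exp_conj _ _ hu, Matrix.exp_diagonal, hexp, ← hX, Matrix.mul_assoc,
    Matrix.mul_nonsing_inv _ ((isUnit_iff_isUnit_det _).1 hu), Matrix.mul_one]

lemma P_zero (γ : ℝ) : S.P γ 0 = 1 := by
  simp [P, S.fundamental.1]

lemma P_add_T (γ t : ℝ) : S.P γ (t + S.T) = S.P γ t := by
  have h : NormedSpace.exp (-((t : ℂ) • S.F γ)) = NormedSpace.exp ((S.T : ℂ) • S.F γ) *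
      NormedSpace.exp (-(((t + S.T : ℝ) : ℂ) • S.F γ)) := by
    rw [← Matrix.exp_add_of_commute]
    · congr 1
      push_cast
      module
    · exact (((Commute.refl (S.F γ)).smul_left _).smul_right _).neg_right
  rw [P, P, S.X_add_T, h, S.exp_F, Matrix.mul_assoc]

lemma det_P_ne_zero (γ t : ℝ) : (S.P γ t).det ≠ 0 := by
  have h : IsUnit (NormedSpace.exp (-((t : ℂ) • S.F γ))) := Matrix.isUnit_exp _
  rw [isUnit_iff_isUnit_det] at h
  rw [P, det_mul]
  exact mul_ne_zero (S.det_X_ne_zero γ t) h.ne_zero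

lemma continuous_P : Continuous fun q : ℝ × ℝ => S.P q.1 q.2 := by
  obtain ⟨C, hC⟩ := S.exists_bound_A
  have hpos : ∀ γ t : ℝ, 0 < t → ContinuousAt (fun q : ℝ × ℝ => S.P q.1 q.2) (γ, t) := by
    intro γ t ht
    refine (S.fundamental.continuousAt hC S.continuous_A γ ht).mul ?_
    have hF := S.continuous_F
    have h1 : Continuous fun q : ℝ × ℝ => -((q.2 : ℂ) • S.F q.1) :=
      ((Complex.continuous_ofReal.comp continuous_snd).smul (hF.comp continuous_fst)).neg
    exact (NormedSpace.exp_continuous.comp h1).continuousAt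
  refine continuous_iff_continuousAt.2 fun ⟨γ, t⟩ => ?_
  -- Continuity of `X` is available only at positive times; time periodicity of `P` carries it to
  -- all times.
  obtain ⟨n, hn⟩ := exists_nat_gt (-t / S.T)
  rw [div_lt_iff₀ S.T_pos] at hn
  have hper : (fun q : ℝ × ℝ => S.P q.1 q.2) =
      (fun q : ℝ × ℝ => S.P q.1 q.2) ∘ fun q => (q.1, q.2 + n • S.T) := by
    funext q
    exact (Function.Periodic.nsmul (S.P_add_T q.1) n q.2).symm
  rw [hper]
  refine ContinuousAt.comp (g := fun q : ℝ × ℝ => S.P q.1 q.2) (hpos γ _ ?_)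
    (Continuous.continuousAt (by fun_prop))
  rw [nsmul_eq_mul]
  linarith

end ParamSystem

/-! ### Periodic logarithms and subgroups of a lattice -/

section Lattices

/-- The homotopy from a constant is lifted through the covering `exp`, starting at a logarithm of
the constant. -/
lemma exists_log_of_nullhomotopic {Y : Type*} [TopologicalSpace Y] {g : C(Y, ℂˣ)}
    (hg : g.Nullhomotopic) : ∃ h : C(Y, ℂ), ∀ y, Complex.exp (h y) = g y := by
  obtain ⟨c, hc⟩ := hg
  obtain ⟨H⟩ := hc.symm
  let ι : C(ℂˣ, {z : ℂ // z ≠ 0}) :=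
    ⟨fun u => ⟨u, u.ne_zero⟩, Units.continuous_val.subtype_mk _⟩
  have h0 : ∀ a, (ι.comp H.toContinuousMap) (0, a) =
      (fun z : ℂ => (⟨_, z.exp_ne_zero⟩ : {z : ℂ // z ≠ 0}))
        ((ContinuousMap.const Y (Complex.log c)) a) := by
    intro a
    refine Subtype.ext ?_
    simp [ι, Complex.exp_log]
  refine ⟨(Complex.isCoveringMap_exp.liftHomotopy (ι.comp H.toContinuousMap) _ h0).comp
    ⟨fun y => (1, y), by fun_prop⟩, fun y => ?_⟩
  have h := congrArg Subtype.val (congrFun (Complex.isCoveringMap_exp.liftHomotopy_lifts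
    (ι.comp H.toContinuousMap) _ h0) (1, y))
  refine Eq.trans h ?_
  simp [ι]

/-- Continuous logarithms of a function with trivial class are periodic. -/
lemma HasTrivialClass.periodic_log {Λ : AddSubgroup ℝ} {f μ : ℝ → ℂ} (h : HasTrivialClass Λ f)
    (hμ : Continuous μ) {c : ℂ} (hc : c ≠ 0) (hf : ∀ γ, Complex.exp (c * μ γ) = f γ) {l : ℝ}
    (hl : l ∈ Λ) (γ : ℝ) : μ (γ + l) = μ γ := by
  obtain ⟨g, hg, hnull⟩ := h
  obtain ⟨h, hh⟩ := exists_log_of_nullhomotopic hnull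
  have hcont : Continuous fun γ : ℝ => h (γ : ℝ ⧸ Λ) :=
    h.continuous.comp QuotientAddGroup.continuous_mk
  -- Two logarithms of the same function on `ℝ` differ by a constant, and `h` is `Λ`-periodic by
  -- construction.
  have hconst := eq_of_exp_eq (ψ := fun γ : ℝ => c * μ γ - h (γ : ℝ ⧸ Λ)) (c := 1)
    ((continuous_const.mul hμ).sub hcont) (fun y => by
      rw [Complex.exp_sub, hf, hh, hg]
      refine div_self ?_
      rw [← hf]
      exact Complex.exp_ne_zero _) (γ + l) γ
  have hcoe : ((γ + l : ℝ) : ℝ ⧸ Λ) = (γ : ℝ) := by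
    rw [QuotientAddGroup.eq]
    simpa using neg_mem hl
  simp only [hcoe, sub_left_inj] at hconst
  exact mul_left_cancel₀ hc hconst

lemma exists_zmultiples_of_le {G : AddSubgroup ℝ} {ℓ : ℝ} (h : G ≤ AddSubgroup.zmultiples ℓ)
    (hG : G ≠ ⊥) : ∃ p : ℝ, 0 < p ∧ G = AddSubgroup.zmultiples p := by
  obtain ⟨a, ha⟩ := Int.subgroup_cyclic (G.comap (zmultiplesHom ℝ ℓ))
  have hrange : G ≤ (zmultiplesHom ℝ ℓ).range := by
    intro x hx
    obtain ⟨k, hk⟩ := AddSubgroup.mem_zmultiples_iff.1 (h hx)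
    exact ⟨k, hk⟩
  have h1 : G = AddSubgroup.zmultiples (a • ℓ) := by
    rw [← AddSubgroup.map_comap_eq_self hrange, ha, ← AddSubgroup.zmultiples_eq_closure,
      AddMonoidHom.map_zmultiples]
    rfl
  have h0 : a • ℓ ≠ 0 := by
    intro h0
    rw [h0, AddSubgroup.zmultiples_zero_eq_bot] at h1
    exact hG h1
  refine ⟨|a • ℓ|, abs_pos.2 h0, ?_⟩
  rcases abs_choice (a • ℓ) with h2 | h2 <;> rw [h2]
  · exact h1
  · rw [AddSubgroup.zmultiples_neg]
    exact h1

end Lattices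

/-! ### Parameter periodicity of `P` and the determinant loop -/

namespace ParamSystem

open Matrix

lemma μ_periodic (S : ParamSystem N) (n : Fin N) {l : ℝ}
    (hl : l ∈ periodLattice (AddSubgroup.zmultiples S.ℓ) (S.lam n)) (γ : ℝ) :
    S.μ n (γ + l) = S.μ n γ :=
  (S.typeIIa_trivial n).periodic_log (S.contDiff_μ n).continuous
    (by exact_mod_cast S.T_pos.ne') (S.exp_μ n) hl γ

/-- If `k_n ℓ` is a nonzero element of `L_n` for each `n`, then `(∏ k_n) ℓ` lies in every `L_n`. -/
lemma Ltilde_ne_bot (S : ParamSystem N) : S.Ltilde ≠ ⊥ := by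
  have h : ∀ n, ∃ k : ℤ, k ≠ 0 ∧
      k • S.ℓ ∈ periodLattice (AddSubgroup.zmultiples S.ℓ) (S.lam n) := by
    intro n
    obtain ⟨⟨x, hx⟩, hx0⟩ := AddSubgroup.ne_bot_iff_exists_ne_zero.1 (S.lattice_ne_bot n)
    obtain ⟨k, rfl⟩ := AddSubgroup.mem_zmultiples_iff.1 hx.1
    refine ⟨k, ?_, hx⟩
    rintro rfl
    exact hx0 (Subtype.ext (zero_smul ℤ _))
  choose k hk0 hk using h
  have hmem : (∏ n, k n) • S.ℓ ∈ S.Ltilde := by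
    rw [Ltilde, AddSubgroup.mem_iInf]
    intro n
    rw [← Finset.prod_erase_mul _ _ (Finset.mem_univ n), mul_smul]
    exact zsmul_mem (hk n) _
  intro hbot
  rw [hbot, AddSubgroup.mem_bot, zsmul_eq_mul] at hmem
  refine mul_ne_zero ?_ S.ℓ_pos.ne' hmem
  exact_mod_cast Finset.prod_ne_zero_iff.2 fun n _ => hk0 n

lemma P_add_of_mem {S : ParamSystem N} (hN : 1 ≤ N) {l : ℝ} (hl : l ∈ S.Ltilde) (γ t : ℝ) :
    S.P (γ + l) t = S.P γ t := by
  have hl' := fun n => AddSubgroup.mem_iInf.1 hl n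
  have hF : S.F (γ + l) = S.F γ := by
    simp only [F, exponentMatrix, S.η_periodic _ l (hl' _), S.μ_periodic _ (hl' _)]
  -- An index is needed here: for `N = 0` the intersection would be all of `ℝ`, not a subgroup of
  -- `ℤℓ`.
  have hX := S.X_param_periodic (hl' ⟨0, hN⟩).1 γ
  rw [P, P, hX]
  exact congrArg (fun M => S.X γ t * NormedSpace.exp (-((t : ℂ) • M))) hF

lemma exists_isDetLoop (S : ParamSystem N) : ∃ w, S.IsDetLoop w := by
  let z : unitInterval → ℂ := fun s =>
    (S.P 0 (s * S.T)).det / (‖(S.P 0 (s * S.T)).det‖ : ℂ)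
  have hne : ∀ s : unitInterval, (S.P 0 (s * S.T)).det ≠ 0 := fun s => S.det_P_ne_zero _ _
  have hcd : Continuous fun s : unitInterval => (S.P 0 (s * S.T)).det :=
    (S.continuous_P.comp (by fun_prop : Continuous fun s : unitInterval =>
      ((0 : ℝ), (s : ℝ) * S.T))).matrix_det
  have hz : Continuous z := hcd.div (by fun_prop) fun s => by
    exact_mod_cast norm_ne_zero_iff.2 (hne s)
  have hnorm : ∀ s, z s ∈ Submonoid.unitSphere ℂ := fun s => by
    refine mem_sphere_zero_iff_norm.2 ?_
    rw [norm_div, Complex.norm_real, norm_norm,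
      div_self (norm_ne_zero_iff.2 (hne s))]
  refine ⟨⟨⟨fun s => (⟨z s, hnorm s⟩ : Circle), hz.subtype_mk _⟩, ?_, ?_⟩, fun s => rfl⟩
  · refine Subtype.ext ?_
    simp [z, S.P_zero]
  · refine Subtype.ext ?_
    have h : S.P 0 S.T = 1 := by
      have := S.P_add_T 0 0
      rwa [zero_add, S.P_zero] at this
    simp [z, h]

end ParamSystem

/-! ### Assembly on the standard torus -/

lemma torusHomeo_apply_coe {p T : ℝ} (hp : p ≠ 0) (hT : T ≠ 0) (x t : ℝ) :
    torusHomeo p T hp hT ((x : UnitAddCircle), (t : UnitAddCircle)) =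
      (((x * p : ℝ) : AddCircle p), ((t * T : ℝ) : AddCircle T)) := by
  simp [torusHomeo]

end Floquet

end

/-- For every `N ≥ 1` there is a function `Φ : π₁(S¹) → [𝕋², GL_N(ℂ)]` such that for every system
the Lyapunov transform is a well-defined map on the torus `ℝ/L̃ × ℝ/Tℤ`, and its Type II.b
homotopy class is the value of `Φ` at the class of the loop `Δ ∘ P ∘ ι`. -/
theorem mainTheorem3 (N : ℕ) (hN : 1 ≤ N) :
    ∃ Φ : FundamentalGroup Circle 1 →
        Floquet.HomotopyClasses (UnitAddCircle × UnitAddCircle)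
          (Matrix.GeneralLinearGroup (Fin N) ℂ),
      ∀ S : Floquet.ParamSystem N,
        ∃ (p : ℝ) (hp : 0 < p), S.Ltilde = AddSubgroup.zmultiples p ∧
          ∃ (f : C(AddCircle p × AddCircle S.T, Matrix.GeneralLinearGroup (Fin N) ℂ))
            (w : Path (1 : Circle) 1),
            S.IsLyapunovMap p f ∧ S.IsDetLoop w ∧
              Floquet.torusClass hp S.T_pos f = Φ (Floquet.loopClass w) := by
  open Floquet ParamSystem in
  obtain ⟨n, rfl⟩ := Nat.exists_eq_add_of_le' hN
  -- `Φ` depends on the class only through its degree, and is fixed before the system `S`.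
  refine ⟨fun c => homotopyClass (standardTorusMap n (circleDegree c)), fun S => ?_⟩
  obtain ⟨p, hp, hpL⟩ := exists_zmultiples_of_le (G := S.Ltilde) (ℓ := S.ℓ)
    (fun x hx => (AddSubgroup.mem_iInf.1 hx 0).1) S.Ltilde_ne_bot
  have hpmem : p ∈ S.Ltilde := hpL ▸ AddSubgroup.mem_zmultiples p
  obtain ⟨G, hG⟩ := exists_torus_lift S.continuous_P (fun x t => P_add_of_mem hN hpmem x t)
    S.P_add_T
  have hGd : ∀ q, (G q).det ≠ 0 := by
    rintro ⟨a, b⟩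
    obtain ⟨a, rfl⟩ := QuotientAddGroup.mk_surjective a
    obtain ⟨b, rfl⟩ := QuotientAddGroup.mk_surjective b
    have h := S.det_P_ne_zero a b
    rwa [← hG] at h
  obtain ⟨w, hw⟩ := S.exists_isDetLoop
  refine ⟨p, hp, hpL, toGLMap G G.continuous hGd, w, hG, hw, ?_⟩
  refine Quotient.sound (MatHomotopic.homotopic ?_)
  have hval : ∀ x t : ℝ, G (torusHomeo p S.T hp.ne' S.T_pos.ne'
      ((x : UnitAddCircle), (t : UnitAddCircle))) = S.P (x * p) (t * S.T) := fun x t => by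
    rw [torusHomeo_apply_coe, hG]
  refine matHomotopic_fourier n (f := fun q => G (torusHomeo p S.T hp.ne' S.T_pos.ne' q))
    (G.continuous.comp (Homeomorph.continuous _)) (fun q => hGd _) (fun x => ?_) (fun s => ?_)
  · obtain ⟨x, rfl⟩ := QuotientAddGroup.mk_surjective x
    have h := hval x 0
    rwa [zero_mul, S.P_zero] at h
  · have h := hval 0 s
    rw [zero_mul] at h
    rw [hw s, ← h]
    rfl
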